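/- Let $\lambda$ be an infinite regular cardinal and let $\mathcal{A}$ be a locally $\lambda$-presentable Grothendieck category. Write $\mathrm{Ext}$ for $\mathrm{Ext}^1_{\mathcal{A}}$. For a class $\mathcal{X}$ of objects put $\mathcal{X}^\perp=\{Y : \mathrm{Ext}(X,Y)=0 \text{ for all } X\in\mathcal{X}\}$ and ${}^\perp\mathcal{X}=\{Y : \mathrm{Ext}(Y,X)=0 \text{ for all } X\in\mathcal{X}\}$, and let $\langle\mathcal{X}\rangle$ be the class of all morphisms of $\mathcal{A}$ that factor through an object of $\mathcal{X}$. An ideal of $\mathcal{A}$ is a class of morphisms whose members $X\to Y$ form a subgroup of $\mathrm{Hom}(X,Y)$ for all $X,Y$, and which is closed under composition on both sides with arbitrary morphisms. For an ideal $\mathcal{J}$ and an ordinal $\alpha>0$, an $\alpha$-composition of morphisms in $\mathcal{J}$ is the morphism $A_0\to A_\alpha$ of a system $(A_\beta)_{\beta\le\alpha}$ in $\mathcal{A}$ indexed by the ordinals $\beta\le\alpha$, such that $A_\beta\to A_{\beta+1}$ is in $\mathcal{J}$ for every $\beta<\alpha$ and the canonical map $\varinjlim_{\gamma<\beta}A_\gamma\to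 A_\beta$ is an isomorphism for every limit ordinal $\beta\le\alpha$. The $\alpha$-th inductive power $\mathcal{J}^{(\alpha)}$ is the ideal generated by all $\alpha$-compositions of morphisms in $\mathcal{J}$. Let $\mathcal{S}$ be a set of $\lambda$-presentable objects of $\mathcal{A}$ such that ${}^\perp(\mathcal{S}^\perp)$ contains a generating set for $\mathcal{A}$, and let $\mathfrak{g}_{\mathcal{S}}$ be the ideal of $\mathcal{S}$-ghost morphisms, that is, of the morphisms $f$ with $\mathrm{Ext}(S,f)=0$ for every $S\in\mathcal{S}$. Then, regarding $\lambda$ as an ordinal, $$\mathfrak{g}_{\mathcal{S}}^{(\lambda)}=\langle\mathcal{S}^\perp\rangle,$$ that is, the Generalized $\lambda$-Generating Hypothesis holds for $\mathfrak{g}_{\mathcal{S}}$. -/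

import Mathlib

open CategoryTheory CategoryTheory.Limits

universe v u w w'

namespace GhostIdeal

noncomputable section

section Ideals

variable {C : Type u} [Category.{v} C] [Preadditive C]

/-- A class of morphisms is an ideal if its members between any two objects form a subgroup of the
group of all morphisms, and it is closed under composition with arbitrary morphisms on both
sides. -/
structure IsIdeal (I : MorphismProperty C) : Prop where
  zero_mem : ∀ X Y : C, I (0 : X ⟶ Y)
  sub_mem : ∀ {X Y : C} (f g : X ⟶ Y), I f → I g → I (f - g)
  comp_mem : ∀ {A X Y B : C} (f : A ⟶ X) (g : X ⟶ Y) (h : Y ⟶ B), I g → I (f ≫ g ≫ h)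

/-- The ideal generated by a class of morphisms: the smallest ideal that contains it. -/
def idealGenerated (W : MorphismProperty C) : MorphismProperty C :=
  fun _ _ f => ∀ I : MorphismProperty C, IsIdeal I → W ≤ I → I f

/-- The `α`-compositions of morphisms in `J`: the composition morphisms `A₀ ⟶ A_α` of the
continuous systems `(A_β)_{β ≤ α}` such that `A_β ⟶ A_{β + 1}` is in `J` for every `β < α`. As the
ordered set `Set.Iic α` of the ordinals `β ≤ α` has a greatest element, the colimit of such a
system is `A_α` itself. -/
def compositions (J : MorphismProperty C) (α : Ordinal.{w}) : MorphismProperty C :=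
  J.transfiniteCompositionsOfShape (Set.Iic α)

/-- The `α`-th inductive power `J^(α)`: the ideal generated by the `α`-compositions of morphisms
in `J`. -/
def inductivePower (J : MorphismProperty C) (α : Ordinal.{w}) : MorphismProperty C :=
  idealGenerated (compositions J α)

/-- The class `⟨P⟩` of the morphisms that factor through an object of `P`. -/
def objectIdeal (P : ObjectProperty C) : MorphismProperty C :=
  fun X Y f => ∃ (Z : C) (i : X ⟶ Z) (p : Z ⟶ Y), P Z ∧ i ≫ p = f

end Ideals

section Ghosts

variable {C : Type u} [Category.{v} C] [Abelian C] [HasExt.{w'} C]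

/-- The `S`-ghost ideal: the morphisms `f` with `Ext¹(A, f) = 0` for every `A` in `S`. -/
def ghostIdeal (S : ObjectProperty C) : MorphismProperty C :=
  fun _ _ f => ∀ A : C, S A → (Abelian.extFunctorObj A 1).map f = 0

/-- `S^⊥`: the objects `X` with `Ext¹(A, X) = 0` for every `A` in `S`. -/
def rightPerp (S : ObjectProperty C) : ObjectProperty C :=
  fun X => ∀ A : C, S A → Subsingleton (Abelian.Ext.{w'} A X 1)

/-- `^⊥P`: the objects `A` with `Ext¹(A, X) = 0` for every `X` in `P`. -/
def leftPerp (P : ObjectProperty C) : ObjectProperty C :=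
  fun A => ∀ X : C, P X → Subsingleton (Abelian.Ext.{w'} A X 1)

/-- The Generalized `α`-Generating Hypothesis for the `S`-ghost ideal. -/
def GeneralizedGeneratingHypothesis (α : Ordinal.{w}) (S : ObjectProperty C) : Prop :=
  inductivePower (ghostIdeal S) α = objectIdeal (rightPerp S)

end Ghosts

end

end GhostIdeal

namespace GhostIdeal

/-! ### `Ext¹` through injective embeddings, ghost preenvelopes and filtered colimits. -/

section Ext

open Abelian

variable {C : Type u} [Category.{v} C] [Abelian C]

/-! The identity of an object of `S^⊥` is a ghost, so constant systems give `⟨S^⊥⟩ ≤ g_S^(κ)`.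

Conversely, given a system of ghosts of length `κ` starting at `A₀`, build a tower on `A₀` by
iterating `exists_ghost_preenvelope`. Each step is a monic ghost through which every ghost from its
source factors, so the tower maps to the system. Its colimit `E` lies in `S^⊥`
(`rightPerp_of_isColimit`): for `κ`-presentable `A` in `S`, a class in `Ext¹(A, E)` comes from some
stage, and the next step kills it. Hence the composition factors through `E`
(`objectIdeal_rightPerp_of_ghost_system`). -/

/-- The short exact sequence of an embedding into an injective object. -/
lemma shortExact_injective_under [EnoughInjectives C] (B : C) :
    (ShortComplex.mk (Injective.ι B) (cokernel.π (Injective.ι B)) (by simp)).ShortExact where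
  exact := ShortComplex.exact_of_g_is_cokernel _ (cokernelIsCokernel _)

variable [HasExt.{w'} C]

lemma exists_extClass_eq {T : ShortComplex C} (hT : T.ShortExact) [Injective T.X₂] {A : C}
    (x : Ext.{w'} A T.X₁ 1) :
    ∃ f : A ⟶ T.X₃, (Ext.mk₀ f).comp hT.extClass (zero_add 1) = x := by
  obtain ⟨y, hy⟩ := Ext.covariant_sequence_exact₁ A hT x (Ext.eq_zero_of_injective _) (zero_add 1)
  obtain ⟨f, rfl⟩ := Ext.addEquiv₀.symm.surjective y
  exact ⟨f, hy⟩

lemma exists_lift_of_mk₀_comp_extClass_eq_zero {T : ShortComplex C} (hT : T.ShortExact) {A : C}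
    (f : A ⟶ T.X₃) (hf : (Ext.mk₀ f).comp hT.extClass (zero_add 1) = (0 : Ext.{w'} A T.X₁ 1)) :
    ∃ g : A ⟶ T.X₂, g ≫ T.g = f := by
  obtain ⟨y, hy⟩ := Ext.covariant_sequence_exact₃ A hT _ (zero_add 1) hf
  obtain ⟨g, rfl⟩ := Ext.addEquiv₀.symm.surjective y
  exact ⟨g, Ext.addEquiv₀.symm.injective (by simpa using hy)⟩

lemma exists_extension_of_extClass_comp_mk₀_eq_zero {T : ShortComplex C} (hT : T.ShortExact)
    {B : C} (f : T.X₁ ⟶ B)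
    (hf : hT.extClass.comp (Ext.mk₀ f) (add_zero 1) = (0 : Ext.{w'} T.X₃ B 1)) :
    ∃ g : T.X₂ ⟶ B, T.f ≫ g = f := by
  obtain ⟨y, hy⟩ := Ext.contravariant_sequence_exact₁ hT B _ (add_zero 1) hf
  obtain ⟨g, rfl⟩ := Ext.addEquiv₀.symm.surjective y
  exact ⟨g, Ext.addEquiv₀.symm.injective (by simpa using hy)⟩

/-- A class is a map to the cosyzygy of `B`, and lifts on the summands assemble to a lift on the
coproduct; no exactness of coproducts is needed. -/
lemma ext_sigma_eq_zero [EnoughInjectives C] {ι : Type*} (Z : ι → C) [HasCoproduct Z] {B : C}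
    (x : Ext.{w'} (∐ Z) B 1)
    (hx : ∀ i, (Ext.mk₀ (Sigma.ι Z i)).comp x (zero_add 1) = 0) : x = 0 := by
  have hT := shortExact_injective_under B
  obtain ⟨f, rfl⟩ := exists_extClass_eq hT x
  have h (i) : ∃ g, g ≫ cokernel.π (Injective.ι B) = Sigma.ι Z i ≫ f :=
    exists_lift_of_mk₀_comp_extClass_eq_zero hT _ (by
      simpa only [Ext.mk₀_comp_mk₀_assoc] using hx i)
  choose g hg using h
  have hf : f = Sigma.desc g ≫ cokernel.π (Injective.ι B) :=
    Sigma.hom_ext _ _ fun i ↦ by simp [hg]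
  rw [hf, ← Ext.mk₀_comp_mk₀_assoc]
  erw [hT.comp_extClass]
  simp

lemma ghostIdeal_iff (S : ObjectProperty C) {X Y : C} (f : X ⟶ Y) :
    ghostIdeal.{v, u, w'} S f ↔ ∀ (A : C), S A → ∀ x : Ext.{w'} A X 1,
      x.comp (Ext.mk₀ f) (add_zero 1) = 0 := by
  refine ⟨fun h A hA x ↦ ?_, fun h A hA ↦ ?_⟩
  · exact DFunLike.congr_fun (congrArg AddCommGrpCat.Hom.hom (h A hA)) x
  · refine AddCommGrpCat.hom_ext (AddMonoidHom.ext fun x ↦ ?_)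
    exact h A hA x

/-- The pullback of a short exact sequence along a morphism to its last term. -/
lemma exists_shortExact_pullback {T : ShortComplex C} (hT : T.ShortExact) {B : C} (b : B ⟶ T.X₃) :
    ∃ (E : C) (i : T.X₁ ⟶ E) (p : E ⟶ B) (w : i ≫ p = 0)
      (h : (ShortComplex.mk i p w).ShortExact),
      (h.extClass : Ext.{w'} B T.X₁ 1) = (Ext.mk₀ b).comp hT.extClass (zero_add 1) := by
  have := hT.mono_f
  have := hT.epi_g
  let i : T.X₁ ⟶ pullback T.g b := pullback.lift T.f 0 (by simp)
  have hi : i ≫ pullback.fst T.g b = T.f := pullback.lift_fst _ _ _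
  have w : i ≫ pullback.snd T.g b = 0 := pullback.lift_snd _ _ _
  have : Mono i := mono_of_mono_fac hi
  have h : (ShortComplex.mk i (pullback.snd T.g b) w).ShortExact :=
    { exact := ShortComplex.exact_of_f_is_kernel _ (KernelFork.IsLimit.ofι' _ _ fun {A} k hk ↦
        ⟨hT.fIsKernel.lift (KernelFork.ofι (k ≫ pullback.fst T.g b) (by
            rw [Category.assoc, pullback.condition, reassoc_of% hk, zero_comp])), by
          have := hT.fIsKernel.fac (KernelFork.ofι (k ≫ pullback.fst T.g b) (by
            rw [Category.assoc, pullback.condition, reassoc_of% hk, zero_comp]))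
              WalkingParallelPair.zero
          apply pullback.hom_ext
          · rw [Category.assoc, hi]
            exact this
          · rw [Category.assoc, w, comp_zero, hk]⟩) }
  refine ⟨_, i, pullback.snd T.g b, w, h, ?_⟩
  have := ShortComplex.ShortExact.extClass_naturality h hT
    { τ₁ := 𝟙 _, τ₂ := pullback.fst T.g b, τ₃ := b, comm₂₃ := pullback.condition }
  simpa using this

/-- Every object `A` has a monomorphism `A ⟶ E` that is an `S`-ghost preenvelope. -/
lemma exists_ghost_preenvelope [EnoughInjectives C] [HasCoproducts.{v} C] (S : ObjectProperty C)
    [ObjectProperty.Small.{v} S] (A : C) :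
    ∃ (E : C) (i : A ⟶ E), Mono i ∧ ghostIdeal.{v, u, w'} S i ∧
      ∀ (B : C) (g : A ⟶ B), ghostIdeal.{v, u, w'} S g → ∃ g' : E ⟶ B, i ≫ g' = g := by
  have hT := shortExact_injective_under A
  let Q := cokernel (Injective.ι A)
  let s : Shrink.{v} (Subtype S) → C := fun k ↦ ((equivShrink _).symm k).1
  let Z : (Σ k, s k ⟶ Q) → C := fun k ↦ s k.1
  let b : ∐ Z ⟶ Q := Sigma.desc fun k ↦ k.2
  obtain ⟨E, i, p, w, h, hE⟩ := exists_shortExact_pullback.{v, u, w'} hT b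
  refine ⟨E, i, h.mono_f, ?_, fun B g hg ↦ ?_⟩
  · rw [ghostIdeal_iff]
    intro X hX x
    obtain ⟨k, rfl⟩ : ∃ k, s k = X := ⟨equivShrink _ ⟨X, hX⟩, by simp [s]⟩
    obtain ⟨f, rfl⟩ := exists_extClass_eq hT x
    -- Every class in `Ext¹(X, A)` restricts the extension `E` along a summand, so `i` kills it.
    have hf : f = Sigma.ι Z ⟨k, f⟩ ≫ b := by simp [b]
    rw [hf, ← Ext.mk₀_comp_mk₀_assoc]
    erw [← hE]
    rw [Ext.comp_assoc_of_third_deg_zero]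
    erw [h.extClass_comp]
    simp
  -- A ghost kills the class of `E` on each summand, hence altogether.
  · refine exists_extension_of_extClass_comp_mk₀_eq_zero h g
      (ext_sigma_eq_zero Z _ fun k ↦ ?_)
    rw [← Ext.comp_assoc_of_third_deg_zero]
    exact (ghostIdeal_iff S g).1 hg _ ((equivShrink _).symm k.1).2 _

/-- A colimit of monomorphisms along a `κ`-filtered category lies in `S^⊥` if every object of the
diagram has an outgoing transition map that is an `S`-ghost. -/
lemma rightPerp_of_isColimit [EnoughInjectives C] (κ : Cardinal.{w}) [Fact κ.IsRegular]
    (S : ObjectProperty C) (hS : S ≤ isCardinalPresentable C κ)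
    {J : Type w} [SmallCategory J] [IsCardinalFiltered J κ] {F : J ⥤ C} {c : Cocone F}
    (hc : IsColimit c) (hmono : ∀ j, Mono (c.ι.app j))
    (hghost : ∀ j, ∃ (j' : J) (u : j ⟶ j'), ghostIdeal.{v, u, w'} S (F.map u)) :
    rightPerp.{v, u, w'} S c.pt := by
  intro A hA
  refine subsingleton_of_forall_eq 0 fun x ↦ ?_
  have hT := shortExact_injective_under c.pt
  let ι (j) : F.obj j ⟶ Injective.under c.pt := c.ι.app j ≫ Injective.ι c.pt
  have hι {j j' : J} (u : j ⟶ j') : F.map u ≫ ι j' = ι j := by simp [ι]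
  let G : J ⥤ C :=
    { obj j := cokernel (ι j)
      map {j j'} u := cokernel.desc _ (cokernel.π (ι j')) (by
        rw [← hι u, Category.assoc, cokernel.condition, comp_zero]) }
  let d : Cocone G :=
    { pt := cokernel (Injective.ι c.pt)
      ι := { app j := cokernel.desc _ (cokernel.π (Injective.ι c.pt)) (by simp [ι])
             naturality j j' u := by
               dsimp [G]
               ext
               simp } }
  have := isFiltered_of_isCardinalFiltered J κ
  -- A cocone on the quotients is a single map from the injective object that kills every stage,
  -- hence kills `c.pt`.
  have hJ (t : Cocone G) (j j' : J) :
      cokernel.π (ι j) ≫ t.ι.app j = cokernel.π (ι j') ≫ t.ι.app j' := by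
    have key {j j' : J} (u : j ⟶ j') :
        cokernel.π (ι j) ≫ t.ι.app j = cokernel.π (ι j') ≫ t.ι.app j' := by
      rw [← t.w u]
      simp [G]
    exact (key (IsFiltered.leftToMax j j')).trans (key (IsFiltered.rightToMax j j')).symm
  have : Nonempty J := IsFiltered.nonempty
  let j₀ : J := Classical.arbitrary J
  let hd : IsColimit d :=
    { desc t := cokernel.desc _ (cokernel.π (ι j₀) ≫ t.ι.app j₀) (hc.hom_ext fun j ↦ by
        rw [hJ t j₀ j, comp_zero, ← Category.assoc, ← Category.assoc]
        exact (congrArg (· ≫ t.ι.app j) (cokernel.condition (ι j))).trans zero_comp)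
      fac t j := by
        dsimp [d]
        apply coequalizer.hom_ext
        simpa using hJ t j₀ j
      uniq t m hm := by
        dsimp [d]
        apply coequalizer.hom_ext
        simp [← hm, d] }
  obtain ⟨f, rfl⟩ := exists_extClass_eq hT x
  have : IsCardinalPresentable A κ := hS A hA
  obtain ⟨j, f', hf'⟩ := IsCardinalPresentable.exists_hom_of_isColimit κ hd f
  have : Mono (ι j) := mono_comp' (hmono j) (inferInstanceAs (Mono (Injective.ι c.pt)))
  have hTj : (ShortComplex.mk (ι j) (cokernel.π (ι j)) (by simp)).ShortExact :=
    { exact := ShortComplex.exact_of_g_is_cokernel _ (cokernelIsCokernel _) }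
  -- The class of `f` is the image of a class in `Ext¹(A, F.obj j)`.
  have nat := ShortComplex.ShortExact.extClass_naturality hTj hT
    { τ₁ := c.ι.app j, τ₂ := 𝟙 _, τ₃ := d.ι.app j, comm₂₃ := by simp [d] }
  obtain ⟨j', u, hu⟩ := hghost j
  rw [← hf', ← Ext.mk₀_comp_mk₀_assoc]
  erw [← nat]
  dsimp
  rw [← c.w u, ← Ext.mk₀_comp_mk₀, ← Ext.comp_assoc_of_third_deg_zero,
    ← Ext.comp_assoc_of_third_deg_zero, (ghostIdeal_iff S _).1 hu _ hA, Ext.zero_comp]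

end Ext

end GhostIdeal

namespace GhostIdeal

/-! ### The tower of preenvelopes over a system of ghosts. -/

section Tower

/-- Colimits are least upper bounds. They supply the indices at the limit stages of the tower. -/
lemma hasColimitsOfShape_of_wellFoundedLT (K : Type*) [LinearOrder K] [OrderTop K]
    [WellFoundedLT K] (J : Type*) [Category* J] : HasColimitsOfShape J K where
  has_colimit F := by
    obtain ⟨m, hm, hmin⟩ :=
      WellFounded.has_min (wellFounded_lt (α := K)) {k | ∀ j, F.obj j ≤ k} ⟨⊤, fun _ ↦ le_top⟩
    exact ⟨⟨{ cocone := { pt := m, ι := { app j := homOfLE (hm j) } }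
              isColimit :=
                { desc t := homOfLE (not_lt.1 (hmin t.pt fun j ↦ leOfHom (t.ι.app j))) } }⟩⟩

variable {C : Type u} [Category.{v} C] [Abelian C] [HasExt.{w'} C]

open SmallObject

/-- The initial morphism of a system of `S`-ghosts that is at least `κ` long factors through an
object of `S^⊥`. The object is the colimit of a tower of `S`-ghost preenvelopes of length `κ`; the
tower and its morphism to the system are built together by iterating in a comma category. -/
lemma objectIdeal_rightPerp_of_ghost_system [IsGrothendieckAbelian.{v} C]
    (κ : Cardinal.{v}) [Fact κ.IsRegular]
    (S : ObjectProperty C) [ObjectProperty.Small.{v} S] (hS : S ≤ isCardinalPresentable C κ)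
    {K : Type w} [LinearOrder K] [OrderBot K] [OrderTop K] [SuccOrder K] [WellFoundedLT K]
    (A : K ⥤ C)
    (hA : ∀ k : K, ¬ IsMax k → ghostIdeal.{v, u, w'} S (A.map (homOfLE (Order.le_succ k))))
    (e : κ.ord.ToType → K) (he : StrictMono e) :
    ∃ k : K, objectIdeal (rightPerp.{v, u, w'} S) (A.map (homOfLE bot_le : ⊥ ⟶ k)) := by
  have : Nonempty κ.ord.ToType := by simpa using Cardinal.IsRegular.ne_zero Fact.out
  let := WellFoundedLT.toOrderBot κ.ord.ToType
  have : NoMaxOrder κ.ord.ToType := Cardinal.noMaxOrder (Cardinal.IsRegular.aleph0_le Fact.out)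
  have : HasColimitsOfSize.{v, v} K := ⟨fun J _ ↦ hasColimitsOfShape_of_wellFoundedLT K J⟩
  -- At a maximal index there is no further ghost to factor, so the step there may be an identity.
  let W : MorphismProperty (Comma (𝟭 C) A) := fun X Y t ↦
    Mono t.left ∧ Y.right ≤ Order.succ X.right ∧
      (¬ IsMax X.right → ghostIdeal.{v, u, w'} S t.left)
  have hW (X : Comma (𝟭 C) A) : ∃ (Y : Comma (𝟭 C) A) (t : X ⟶ Y), W t := by
    by_cases hX : IsMax X.right
    · exact ⟨X, 𝟙 X, inferInstanceAs (Mono (𝟙 X.left)), Order.le_succ _, fun h ↦ (h hX).elim⟩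
    · obtain ⟨E, i, hi, hi', hE⟩ := exists_ghost_preenvelope.{v, u, w'} S X.left
      obtain ⟨g, hg⟩ := hE _ (X.hom ≫ A.map (homOfLE (Order.le_succ X.right)))
        ((ghostIdeal_iff _ _).2 fun B hB x ↦ by
          rw [← Abelian.Ext.mk₀_comp_mk₀, ← Abelian.Ext.comp_assoc_of_third_deg_zero]
          exact (ghostIdeal_iff _ _).1 (hA _ hX) B hB _)
      exact ⟨{ left := E, right := Order.succ X.right, hom := g },
        { left := i, right := homOfLE (Order.le_succ _), w := hg }, hi, le_rfl, fun _ ↦ hi'⟩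
  choose Y t ht using hW
  let Φ : SuccStruct (Comma (𝟭 C) A) :=
    { X₀ := { left := A.obj ⊥, right := ⊥, hom := 𝟙 _ }, succ := Y, toSucc := t }
  let h : W.TransfiniteCompositionOfShape κ.ord.ToType (Φ.ιIteration κ.ord.ToType) :=
    (Φ.transfiniteCompositionOfShapeιIteration κ.ord.ToType).ofLE (by rintro _ _ _ ⟨⟩; exact ht _)
  have : PreservesWellOrderContinuousOfShape κ.ord.ToType (Comma.fst (𝟭 C) A) := { }
  let h' : (MorphismProperty.monomorphisms C).TransfiniteCompositionOfShape κ.ord.ToType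
      ((Comma.fst _ _).map (Φ.ιIteration κ.ord.ToType)) := (h.ofLE (fun _ _ _ hf ↦ hf.1)).map
  -- Indices grow by at most one successor, so `e` bounds them away from the maximum and every step
  -- is a ghost.
  have hright (j : κ.ord.ToType) : (h.F.obj j).right ≤ e j := by
    induction j using SuccOrder.limitRecOn with
    | isMin j hj =>
      obtain rfl := hj.eq_bot
      exact (leOfHom h.isoBot.hom.right).trans bot_le
    | succ j hj hj' =>
      exact (h.map_mem j hj).2.1.trans
        ((Order.succ_mono hj').trans (Order.succ_le_of_lt (he (Order.lt_succ j))))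
    | isSuccLimit j hj hj' =>
      let d := isColimitOfPreserves (Comma.snd (𝟭 C) A) (h.F.isColimitOfIsWellOrderContinuous j hj)
      exact leOfHom (d.desc
        { pt := e j
          ι := { app i := homOfLE ((hj' i.1 i.2).trans (he i.2).le) } })
  have hmax (j : κ.ord.ToType) : ¬ IsMax (h.F.obj j).right :=
    not_isMax_of_lt ((hright j).trans_lt (he (Order.lt_succ j)))
  refine ⟨(Φ.iteration κ.ord.ToType).right, (Φ.iteration κ.ord.ToType).left,
    (Φ.ιIteration κ.ord.ToType).left, (Φ.iteration κ.ord.ToType).hom, ?_, ?_⟩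
  · exact rightPerp_of_isColimit κ S hS h'.isColimit h'.mem_incl_app fun j ↦
      ⟨Order.succ j, homOfLE (Order.le_succ j), (h.map_mem j (not_isMax j)).2.2 (hmax j)⟩
  · refine (Φ.ιIteration κ.ord.ToType).w.trans ?_
    exact Category.id_comp _

end Tower

/-! ### Constant systems and the ideal `⟨S^⊥⟩`. -/

section Main

lemma id_mem_compositions {C : Type u} [Category.{v} C] [Preadditive C]
    (J : MorphismProperty C) {X : C} (hX : J (𝟙 X)) (α : Ordinal.{w}) :
    compositions J α (𝟙 X) :=
  ⟨{ F := (Functor.const _).obj X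
     isoBot := Iso.refl _
     isWellOrderContinuous :=
      { nonempty_isColimit := fun m hm ↦ by
          have := hm.nonempty_Iio.to_subtype
          exact ⟨isColimitConstCocone _ _⟩ }
     incl := 𝟙 _
     isColimit := isColimitConstCocone _ _
     map_mem := fun _ _ ↦ hX }⟩

open ZeroObject

variable {C : Type u} [Category.{v} C] [Abelian C] [HasExt.{w'} C]

lemma rightPerp_zero (S : ObjectProperty C) : rightPerp.{v, u, w'} S (0 : C) := fun A _ ↦
  subsingleton_of_forall_eq 0 fun x ↦ by
    rw [← Abelian.Ext.comp_mk₀_id x, (isZero_zero C).eq_of_src (𝟙 (0 : C)) 0]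
    simp

lemma rightPerp_biprod (S : ObjectProperty C) {X Y : C} (hX : rightPerp.{v, u, w'} S X)
    (hY : rightPerp.{v, u, w'} S Y) : rightPerp.{v, u, w'} S (X ⊞ Y) := fun A hA ↦
  subsingleton_of_forall_eq 0 fun x ↦ by
    have := hX A hA
    have := hY A hA
    rw [← Abelian.Ext.comp_mk₀_id x, ← biprod.total, Abelian.Ext.mk₀_add, Abelian.Ext.comp_add,
      ← Abelian.Ext.mk₀_comp_mk₀, ← Abelian.Ext.mk₀_comp_mk₀,
      ← Abelian.Ext.comp_assoc_of_third_deg_zero, ← Abelian.Ext.comp_assoc_of_third_deg_zero,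
      Subsingleton.elim (x.comp (Abelian.Ext.mk₀ biprod.fst) (add_zero 1)) 0,
      Subsingleton.elim (x.comp (Abelian.Ext.mk₀ biprod.snd) (add_zero 1)) 0]
    simp

lemma isIdeal_objectIdeal_rightPerp (S : ObjectProperty C) :
    IsIdeal (objectIdeal (rightPerp.{v, u, w'} S)) where
  zero_mem X Y := ⟨0, 0, 0, rightPerp_zero S, by simp⟩
  sub_mem := by
    rintro X Y _ _ ⟨Z, i, p, hZ, rfl⟩ ⟨Z', i', p', hZ', rfl⟩
    exact ⟨Z ⊞ Z', biprod.lift i i', biprod.desc p (-p'), rightPerp_biprod S hZ hZ', by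
      simp [biprod.lift_desc, sub_eq_add_neg]⟩
  comp_mem := by
    rintro A X Y B f _ h ⟨Z, i, p, hZ, rfl⟩
    exact ⟨Z, f ≫ i, p ≫ h, hZ, by simp⟩

lemma ghostIdeal_of_rightPerp (S : ObjectProperty C) {X Y : C} (f : X ⟶ Y)
    (hX : rightPerp.{v, u, w'} S X) : ghostIdeal.{v, u, w'} S f :=
  (ghostIdeal_iff S f).2 fun A hA x ↦ by
    have := hX A hA
    rw [Subsingleton.elim x 0, Abelian.Ext.zero_comp]

end Main

end GhostIdeal

theorem theorem6p9 (C : Type u) [Category.{v} C] [Abelian C] [IsGrothendieckAbelian.{v} C]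
    (κ : Cardinal.{v}) [Fact κ.IsRegular] [IsCardinalLocallyPresentable C κ]
    (S : ObjectProperty C) [ObjectProperty.Small.{v} S]
    (hS : S ≤ isCardinalPresentable C κ)
    (hG : ∃ G : ObjectProperty C, ObjectProperty.Small.{v} G ∧ G.IsSeparating ∧
      G ≤ GhostIdeal.leftPerp (GhostIdeal.rightPerp S)) :
    GhostIdeal.GeneralizedGeneratingHypothesis κ.ord S := by
  apply le_antisymm
  · intro X Y f hf
    refine hf _ (GhostIdeal.isIdeal_objectIdeal_rightPerp S) ?_
    rintro X Y f ⟨h⟩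
    let e : κ.ord.ToType → Set.Iic κ.ord := fun j ↦ 
      ⟨j.toOrd, le_of_lt (Set.mem_Iio.1 j.toOrd.2)⟩
    obtain ⟨k, hk⟩ := GhostIdeal.objectIdeal_rightPerp_of_ghost_system κ S hS h.F h.map_mem e
      fun _ _ hij ↦ Ordinal.ToType.mk.symm.strictMono hij
    -- The index `k` need not be the top; the ideal absorbs the rest of the composition.
    have := (GhostIdeal.isIdeal_objectIdeal_rightPerp S).comp_mem h.isoBot.inv _ (h.incl.app k) hk
    simpa using this
  · rintro X Y _ ⟨Z, i, p, hZ, rfl⟩ I hI hJ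
    have := hI.comp_mem i (𝟙 Z) p
      (hJ _ (GhostIdeal.id_mem_compositions _ (GhostIdeal.ghostIdeal_of_rightPerp S _ hZ) _))
    simpa using this
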